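/- A $2$-colouring of $K_n$ is a colouring of the edges of the complete graph $K_n$ in red and blue; it is called locally $\delta$-balanced if every vertex is incident to at least $\delta n$ red edges and at least $\delta n$ blue edges. It is said to contain a $t$-blow-up of $P_1$ if there are disjoint sets $V_1,V_2$ of $t$ vertices each such that all edges inside $V_1$ and inside $V_2$ are red and all edges between $V_1$ and $V_2$ are blue; a $t$-blow-up of $\overline{P_1}$ is the same with the two colours interchanged. **Theorem.** There is an absolute constant $C>0$ such that the following holds for all $\varepsilon>0$ and all non-negative integers $t,n$ with $$n\ \ge\ 2^{\,t\cdot 2^{\,C(\log(1/\varepsilon))^8}}.$$ Every locally $(1/4+\varepsilon)$-balanced $2$-colouring of $K_n$ contains a $t$-blow-up of $P_1$ or of $\overline{P_1}$; in other words, it contains $2t$ vertices on which the edges of one of the colours form exactly a $K_{t,t}$. The threshold $1/4$ is sharp. For $k\ge 1$ let $\mathcal P_k$ be the following $2$-colouring of $K_{4k}$: partition the vertices into sets $V_1,V_2,V_3,V_4$ of size $k$; colour red all edges inside $V_1\cup V_4$, all edges between $V_1$ and $V_3$, and all edges between $V_2$ and $V_4$; colour blue all edges inside $V_2\cup V_3$,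 all edges between $V_1$ and $V_2$, and all edges between $V_3$ and $V_4$. Then $\mathcal P_k$ is locally $1/4$-balanced, but for every $t\ge 2$ it contains no $t$-blow-up of $P_1$ or of $\overline{P_1}$; that is, it has no $2t$ vertices on which the edges of one of the colours form exactly a $K_{t,t}$. -/

import Mathlib

namespace BalancedRamsey

/-- The two colours. -/
inductive Colour
  | red
  | blue
  deriving DecidableEq

/-- Interchange the two colours. -/
def Colour.swap : Colour → Colour
  | .red => .blue
  | .blue => .red

/-- A 2-edge-colouring of the complete graph on the vertex set `V`. The graph formed by the edges
of colour `c` in the colouring `χ` is `χ.labelGraph c`. -/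
abbrev Colouring (V : Type*) := SimpleGraph.TopEdgeLabeling V Colour

/-- Each vertex is incident to at least `ε |V|` edges of each colour. -/
def LocallyBalanced {V : Type*} [Fintype V] (ε : ℝ) (χ : Colouring V) : Prop :=
  ∀ (v : V) (c : Colour),
    ε * (Fintype.card V : ℝ) ≤ (((χ.labelGraph c).neighborSet v).ncard : ℝ)

/-- A totally 2-coloured graph: both its edges and its vertices carry a colour. -/
structure TotallyColouredGraph (W : Type*) where
  graph : SimpleGraph W
  edgeColour : graph.EdgeLabeling Colour
  vertexColour : W → Colour

/-- The totally-coloured graph with the two colours interchanged. -/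
def TotallyColouredGraph.bar {W : Type*} (H : TotallyColouredGraph W) :
    TotallyColouredGraph W where
  graph := H.graph
  edgeColour := H.edgeColour.compRight Colour.swap
  vertexColour := fun i => (H.vertexColour i).swap

/-- The 2-coloured complete graph `χ` contains a `t`-blow-up of the totally-coloured graph `H`:
there are pairwise disjoint sets `S i` of `t` vertices, one for each vertex `i` of `H`, such that
`S i` is a monochromatic clique in the colour of `i`, and all edges between `S i` and `S j` have
the colour of the edge `ij` whenever `ij` is an edge of `H`. -/
def ContainsBlowUp {V W : Type*} (χ : Colouring V) (t : ℕ) (H : TotallyColouredGraph W) : Prop :=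
  ∃ S : W → Finset V,
    (∀ i, (S i).card = t) ∧
    (∀ i j, i ≠ j → Disjoint (S i) (S j)) ∧
    (∀ i, ∀ x ∈ S i, ∀ y ∈ S i, x ≠ y → (χ.labelGraph (H.vertexColour i)).Adj x y) ∧
    (∀ i j, ∀ h : H.graph.Adj i j, ∀ x ∈ S i, ∀ y ∈ S j,
      (χ.labelGraph (H.edgeColour.get i j h)).Adj x y)

/-- `P₁`: the totally-coloured `K₂` with both vertices red and the edge blue. -/
def P₁ : TotallyColouredGraph (Fin 2) where
  graph := ⊤
  edgeColour := fun _ => Colour.blue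
  vertexColour := fun _ => Colour.red

/-- There are `2t` vertices on which the edges of one of the two colours form exactly
a `K_{t,t}`. -/
def HasInducedBipartite {V : Type*} (χ : Colouring V) (t : ℕ) : Prop :=
  ∃ (c : Colour) (S : Finset V), S.card = 2 * t ∧
    Nonempty ((χ.labelGraph c).induce (S : Set V) ≃g completeBipartiteGraph (Fin t) (Fin t))

/-- The colours inside and between the four parts `V₁, V₂, V₃, V₄` (indexed from `0`):
red inside `V₁ ∪ V₄`, blue inside `V₂ ∪ V₃`, red between `V₁, V₃` and between `V₂, V₄`,
blue between `V₁, V₂` and between `V₃, V₄`. -/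
def partColour : Fin 4 → Fin 4 → Colour :=
  ![![.red,  .blue, .red,  .red],
    ![.blue, .blue, .blue, .red],
    ![.red,  .blue, .blue, .blue],
    ![.red,  .red,  .blue, .red]]

theorem partColour_comm : ∀ i j : Fin 4, partColour j i = partColour i j := by
  decide

/-- The 2-coloured complete graph `𝒫_k` on `4k` vertices; the part `V_{i+1}` is the set of
vertices with first coordinate `i`. -/
def fourPart (k : ℕ) : Colouring (Fin 4 × Fin k) :=
  SimpleGraph.EdgeLabeling.mk (fun x y _ => partColour x.1 y.1)
    (fun x y _ => partColour_comm x.1 y.1)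

end BalancedRamsey

/-!
Write `G` for the red graph and suppose that neither `G` nor `Gᶜ` has two `t`-cliques with no edge
between them. Greedily removing large sets without a `G`-clique on `T ≈ 3t / ε` vertices splits the
vertices into `A` and `Aᶜ`, such that every large subset of `A` contains a `T`-clique of `G` and,
by Ramsey's theorem applied to the removed sets, every large subset of `Aᶜ` contains a `T`-clique
of `Gᶜ`. If `R ⊆ A` is a `T`-clique of `G`, only few vertices of `A` have `t` non-neighbours in
`R`: otherwise some `t` vertices of `R` would have many common non-neighbours in `A`, among which
there is a `t`-clique separated from them. Since almost all of `A` is covered by disjoint such `R`,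
the graph `Gᶜ` has few edges inside `A`, and symmetrically `G` has few edges inside `Aᶜ`.

Now count the blue degrees in `A` and the red degrees in `Aᶜ`: they add up to at least
`(1/4 + ε) n²`, whereas the pairs between `A` and `Aᶜ`, each of which is counted once, contribute
only `|A| |Aᶜ| ≤ n² / 4`.
-/

namespace BalancedRamsey

open Finset SimpleGraph

variable {V : Type*}

theorem card_lt_two_pow_of_cliqueFreeOn {G : SimpleGraph V} {a b : ℕ} {W : Finset V}
    (hG : G.CliqueFreeOn W a) (hGc : Gᶜ.CliqueFreeOn W b) : #W < 2 ^ (a + b) := by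
  classical
  induction a generalizing b W with
  | zero => exact absurd (isNClique_empty.2 rfl) (hG (by simp))
  | succ a iha =>
    induction b generalizing W with
    | zero => exact absurd (isNClique_empty.2 rfl) (hGc (by simp))
    | succ b ihb =>
      obtain rfl | ⟨v, hv⟩ := W.eq_empty_or_nonempty
      · simp
      have hN : #{x ∈ W | G.Adj v x} < 2 ^ (a + (b + 1)) :=
        iha (by simpa [Set.inter_def] using hG.of_succ _ hv)
          (hGc.subset _ (by exact_mod_cast filter_subset _ _))
      have hM : #{x ∈ W | Gᶜ.Adj v x} < 2 ^ (a + 1 + b) :=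
        ihb (hG.subset _ (by exact_mod_cast filter_subset _ _))
          (by simpa [Set.inter_def] using hGc.of_succ _ hv)
      have hW : #W ≤ #{x ∈ W | G.Adj v x} + #{x ∈ W | Gᶜ.Adj v x} + 1 := by
        rw [← card_erase_add_one hv, Nat.add_le_add_iff_right]
        refine (card_le_card fun x hx => ?_).trans (card_union_le _ _)
        obtain ⟨hxv, hxW⟩ := mem_erase.1 hx
        by_cases hvx : G.Adj v x <;> simp [hvx, hxW, hxv.symm]
      have : 2 ^ (a + 1 + (b + 1)) = 2 ^ (a + (b + 1)) + 2 ^ (a + 1 + b) := by ring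
      omega

/-- Large subsets of `Z` contain large cliques: every subset of `Z` without a `G`-clique on `T`
vertices has at most `ρ` elements. -/
def CliqueRich (G : SimpleGraph V) (T ρ : ℕ) (Z : Finset V) : Prop :=
  ∀ W ⊆ Z, G.CliqueFreeOn W T → #W ≤ ρ

theorem CliqueRich.mono {G : SimpleGraph V} {T T' ρ ρ' : ℕ} {Z : Finset V}
    (h : CliqueRich G T ρ Z) (hT : T' ≤ T) (hρ : ρ ≤ ρ') : CliqueRich G T' ρ' Z :=
  fun W hWZ hW => (h W hWZ (hW.mono _ hT)).trans hρ

theorem CliqueRich.union [DecidableEq V] {G : SimpleGraph V} {T ρ σ : ℕ} {Y Z : Finset V}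
    (hY : CliqueRich G T ρ Y) (hZ : CliqueRich G T σ Z) : CliqueRich G T (ρ + σ) (Y ∪ Z) := by
  intro W hW hfree
  have hinter (X : Finset V) : G.CliqueFreeOn (W ∩ X : Finset V) T :=
    hfree.subset _ (by exact_mod_cast inter_subset_left)
  calc #W = #(W ∩ Y ∪ W ∩ Z) := by rw [← inter_union_distrib_left, inter_eq_left.2 hW]
    _ ≤ #(W ∩ Y) + #(W ∩ Z) := card_union_le _ _
    _ ≤ ρ + σ := Nat.add_le_add (hY _ inter_subset_right (hinter Y))
        (hZ _ inter_subset_right (hinter Z))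

theorem cliqueRich_compl_of_cliqueFreeOn {G : SimpleGraph V} {a b : ℕ} {S : Finset V}
    (hS : G.CliqueFreeOn S a) : CliqueRich Gᶜ b (2 ^ (a + b)) S :=
  fun _ hWS hW =>
    (card_lt_two_pow_of_cliqueFreeOn (hS.subset _ (by exact_mod_cast hWS)) hW).le

theorem exists_cliqueRich_and_cliqueRich_compl_sdiff [DecidableEq V] (G : SimpleGraph V)
    (a b m : ℕ) (Z : Finset V) :
    ∃ A ⊆ Z, CliqueRich G a m A ∧
      ∃ k, k * m ≤ #Z ∧ CliqueRich Gᶜ b (k * 2 ^ (a + b)) (Z \ A) := by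
  induction Z using Finset.strongInduction with
  | H Z ih =>
    by_cases hZ : CliqueRich G a m Z
    · exact ⟨Z, subset_rfl, hZ, 0, by simp, by simp +contextual [CliqueRich]⟩
    simp only [CliqueRich, not_forall, not_le] at hZ
    obtain ⟨S, hSZ, hS, hmS⟩ := hZ
    obtain ⟨A, hA, hrich, k, hk, hrich'⟩ :=
      ih (Z \ S) (sdiff_ssubset hSZ (card_pos.1 (by omega)))
    refine ⟨A, hA.trans sdiff_subset, hrich, k + 1, ?_, ?_⟩
    · have := card_sdiff_add_card_eq_card hSZ
      rw [add_one_mul]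
      omega
    · have hunion : Z \ A = (Z \ S) \ A ∪ S := by
        ext x
        have := @hSZ x
        have := @hA x
        simp only [mem_sdiff, mem_union] at *
        tauto
      rw [hunion, add_one_mul]
      exact hrich'.union (cliqueRich_compl_of_cliqueFreeOn hS)

theorem exists_cliqueRich_and_cliqueRich_compl [Fintype V] [DecidableEq V] (G : SimpleGraph V)
    {T : ℕ} (hT : 2 ^ (8 * T) ≤ Fintype.card V) :
    ∃ (A : Finset V) (ρ : ℕ), ρ * 2 ^ (3 * T) ≤ Fintype.card V ∧
      CliqueRich G T ρ A ∧ CliqueRich Gᶜ T ρ Aᶜ := by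
  obtain ⟨A, -, hA, k, hk, hAc⟩ :=
    exists_cliqueRich_and_cliqueRich_compl_sdiff G T T (2 ^ (5 * T)) univ
  refine ⟨A, max (2 ^ (5 * T)) (k * 2 ^ (T + T)), ?_, hA.mono le_rfl (le_max_left _ _),
    hAc.mono le_rfl (le_max_right _ _)⟩
  rcases max_choice (2 ^ (5 * T)) (k * 2 ^ (T + T)) with h | h <;> rw [h]
  · exact (by ring : 2 ^ (5 * T) * 2 ^ (3 * T) = 2 ^ (8 * T)).trans_le hT
  · exact (by ring : k * 2 ^ (T + T) * 2 ^ (3 * T) = k * 2 ^ (5 * T)).trans_le hk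

/-- There are two cliques of `G` on `t` vertices each with no edge of `G` between them; the edges
of the complementary colour on their union form a `K_{t,t}`. -/
def HasSeparatedCliques (G : SimpleGraph V) (t : ℕ) : Prop :=
  ∃ S S' : Finset V, G.IsNClique t S ∧ G.IsNClique t S' ∧ ∀ x ∈ S, ∀ y ∈ S', Gᶜ.Adj x y

theorem mul_sum_le_of_forall_exists_subset {α : Type*} {f : α → ℕ} {T ρ c M : ℕ} {Z : Finset α}
    (hT : 0 < T) (hsub : ∀ W ⊆ Z, ρ < #W → ∃ R ⊆ W, #R = T ∧ ∑ x ∈ R, f x ≤ c)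
    (hM : ∀ x ∈ Z, f x ≤ M) : T * ∑ x ∈ Z, f x ≤ #Z * c + T * (ρ * M) := by
  classical
  induction Z using Finset.strongInduction with
  | H Z ih =>
    rcases le_or_gt #Z ρ with hZ | hZ
    · calc T * ∑ x ∈ Z, f x ≤ T * (#Z * M) := by gcongr; exact sum_le_card_nsmul _ _ _ hM
        _ ≤ T * (ρ * M) := by gcongr
        _ ≤ _ := Nat.le_add_left _ _
    · obtain ⟨R, hRZ, hRT, hRc⟩ := hsub Z subset_rfl hZ
      have hrest := ih (Z \ R) (sdiff_ssubset hRZ (card_pos.1 (hRT ▸ hT)))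
        (fun W hW => hsub W (hW.trans sdiff_subset)) (fun x hx => hM x (sdiff_subset hx))
      calc T * ∑ x ∈ Z, f x = T * ∑ x ∈ Z \ R, f x + T * ∑ x ∈ R, f x := by
            rw [← sum_sdiff hRZ, mul_add]
        _ ≤ (#(Z \ R) * c + T * (ρ * M)) + T * c := by gcongr
        _ = (#(Z \ R) + #R) * c + T * (ρ * M) := by rw [hRT]; ring
        _ = _ := by rw [card_sdiff_add_card_eq_card hRZ]

theorem card_interedges_eq_sum (G : SimpleGraph V) [DecidableRel G.Adj]
    (s t : Finset V) :
    #(G.interedges s t) = ∑ x ∈ s, #{y ∈ t | G.Adj x y} := by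
  simp only [interedges_def, card_filter, sum_product]

section Counting

variable [DecidableEq V] {G : SimpleGraph V} [DecidableRel G.Adj]

theorem card_filter_le_card_compl_adj_le {t ρ : ℕ} {R Z : Finset V}
    (hG : ¬ HasSeparatedCliques G t) (hZ : CliqueRich G t ρ Z) (hR : G.IsClique R) :
    #{y ∈ Z | t ≤ #{x ∈ R | Gᶜ.Adj x y}} ≤ (#R).choose t * ρ := by
  have hcover : {y ∈ Z | t ≤ #{x ∈ R | Gᶜ.Adj x y}} ⊆
      (R.powersetCard t).biUnion fun S => {y ∈ Z | ∀ x ∈ S, Gᶜ.Adj x y} := by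
    intro y hy
    obtain ⟨hyZ, hyt⟩ := mem_filter.1 hy
    obtain ⟨S, hS, hSt⟩ := exists_subset_card_eq hyt
    exact mem_biUnion.2 ⟨S, mem_powersetCard.2 ⟨hS.trans (filter_subset _ _), hSt⟩,
      mem_filter.2 ⟨hyZ, fun x hx => (mem_filter.1 (hS hx)).2⟩⟩
  have hfiber : ∀ S ∈ R.powersetCard t, #{y ∈ Z | ∀ x ∈ S, Gᶜ.Adj x y} ≤ ρ := by
    intro S hS
    obtain ⟨hSR, hSt⟩ := mem_powersetCard.1 hS
    refine hZ _ (filter_subset _ _) fun S' hS' hclique => hG ⟨S, S', ?_, hclique, ?_⟩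
    · exact ⟨hR.subset (by exact_mod_cast hSR), hSt⟩
    · exact fun x hx y hy => (mem_filter.1 (hS' hy)).2 x hx
  calc _ ≤ _ := card_le_card hcover
    _ ≤ #(R.powersetCard t) * ρ := card_biUnion_le_card_mul _ _ _ hfiber
    _ = (#R).choose t * ρ := by rw [card_powersetCard]

theorem card_interedges_compl_le_of_isClique {t ρ : ℕ} {R Z : Finset V}
    (hG : ¬ HasSeparatedCliques G t) (hZ : CliqueRich G t ρ Z) (hR : G.IsClique R) :
    #(Gᶜ.interedges R Z) ≤ t * #Z + #R * ((#R).choose t * ρ) := by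
  calc #(Gᶜ.interedges R Z)
      = ∑ y ∈ Z, #{x ∈ R | Gᶜ.Adj x y} := by
        rw [card_interedges_eq_sum]
        exact sum_card_bipartiteAbove_eq_sum_card_bipartiteBelow _
    _ ≤ ∑ y ∈ Z, (t + if t ≤ #{x ∈ R | Gᶜ.Adj x y} then #R else 0) := by
        gcongr with y
        split_ifs with h
        · exact (card_filter_le _ _).trans (Nat.le_add_left _ _)
        · exact (not_le.1 h).le
    _ = t * #Z + #R * #{y ∈ Z | t ≤ #{x ∈ R | Gᶜ.Adj x y}} := by
        rw [sum_add_distrib, ← sum_filter, sum_const, sum_const, smul_eq_mul, smul_eq_mul,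
          mul_comm, mul_comm #R]
    _ ≤ _ := by gcongr; exact card_filter_le_card_compl_adj_le hG hZ hR

theorem CliqueRich.mul_card_interedges_compl_self_le {t T ρ : ℕ} {Z : Finset V}
    (hZ : CliqueRich G T ρ Z) (hG : ¬ HasSeparatedCliques G t) (hT : 0 < T) (htT : t ≤ T) :
    T * #(Gᶜ.interedges Z Z) ≤ #Z * (t * #Z + 2 * T * (2 ^ T * ρ)) := by
  have hsub : ∀ W ⊆ Z, ρ < #W → ∃ R ⊆ W, #R = T ∧
      ∑ x ∈ R, #{y ∈ Z | Gᶜ.Adj x y} ≤ t * #Z + T * (2 ^ T * ρ) := by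
    intro W hWZ hW
    obtain ⟨R, hRW, hR⟩ : ∃ R ⊆ W, G.IsNClique T R := by
      by_contra! hfree
      exact hW.not_ge (hZ W hWZ fun R hR => hfree R (by exact_mod_cast hR))
    refine ⟨R, hRW, hR.card_eq, ?_⟩
    rw [← card_interedges_eq_sum]
    refine (card_interedges_compl_le_of_isClique hG (hZ.mono htT le_rfl) hR.isClique).trans ?_
    rw [hR.card_eq]
    gcongr
    exact Nat.choose_le_two_pow T t
  calc T * #(Gᶜ.interedges Z Z)
      ≤ #Z * (t * #Z + T * (2 ^ T * ρ)) + T * (ρ * #Z) := by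
        rw [card_interedges_eq_sum]
        exact mul_sum_le_of_forall_exists_subset hT hsub fun _ _ => card_filter_le _ _
    _ = #Z * (t * #Z + T * (2 ^ T * ρ)) + #Z * (T * (1 * ρ)) := by ring
    _ ≤ #Z * (t * #Z + T * (2 ^ T * ρ)) + #Z * (T * (2 ^ T * ρ)) := by
        gcongr; exact Nat.one_le_two_pow
    _ = _ := by ring

variable [Fintype V]

theorem card_mul_le_card_interedges_add {d : ℝ} (hd : ∀ v, d ≤ G.degree v) (A : Finset V) :
    #A * d ≤ #(G.interedges A A) + #(G.interedges A Aᶜ) := by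
  have hdegree (v : V) : G.degree v = #{w ∈ A | G.Adj v w} + #{w ∈ Aᶜ | G.Adj v w} := by
    rw [← card_union_of_disjoint (disjoint_filter_filter disjoint_compl_right), ← filter_union,
      union_compl, ← card_neighborFinset_eq_degree, neighborFinset_eq_filter]
  calc #A * d = ∑ _v ∈ A, d := by rw [sum_const, nsmul_eq_mul]
    _ ≤ ∑ v ∈ A, (G.degree v : ℝ) := sum_le_sum fun v _ => hd v
    _ = _ := by simp only [hdegree, card_interedges_eq_sum, Nat.cast_add, Nat.cast_sum,
      sum_add_distrib]

theorem mul_sq_card_le_card_interedges_compl_add {ε : ℝ}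
    (hG : ∀ v, (1 / 4 + ε) * Fintype.card V ≤ G.degree v)
    (hGc : ∀ v, (1 / 4 + ε) * Fintype.card V ≤ Gᶜ.degree v) (A : Finset V) :
    ε * (Fintype.card V : ℝ) ^ 2 ≤ #(Gᶜ.interedges A A) + #(G.interedges Aᶜ Aᶜ) := by
  have hA := card_mul_le_card_interedges_add hGc A
  have hAc := card_mul_le_card_interedges_add hG Aᶜ
  rw [compl_compl, show #(G.interedges Aᶜ A) = #(G.interedges A Aᶜ) from
    have := G.symm; Rel.card_interedges_comm _ _] at hAc
  have hcross : (#(G.interedges A Aᶜ) + #(Gᶜ.interedges A Aᶜ) : ℝ) = #A * #Aᶜ := by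
    exact_mod_cast G.card_interedges_add_card_interedges_compl disjoint_compl_right
  have hcard : (Fintype.card V : ℝ) = #A + #Aᶜ := by exact_mod_cast (card_add_card_compl A).symm
  have hprod : (#A : ℝ) * #Aᶜ ≤ (Fintype.card V : ℝ) ^ 2 / 4 := by
    rw [hcard]
    linarith [sq_nonneg ((#A : ℝ) - #Aᶜ)]
  have hsum : (1 / 4 + ε) * (Fintype.card V : ℝ) ^ 2 =
      #A * ((1 / 4 + ε) * Fintype.card V) + #Aᶜ * ((1 / 4 + ε) * Fintype.card V) := by
    rw [← add_mul, ← hcard]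
    ring
  linarith

theorem hasSeparatedCliques_or_compl {ε : ℝ} {t T : ℕ} (ht : 0 < t)
    (htT : t ≤ T) (hT : 3 * t ≤ ε * T) (hn : 2 ^ (8 * T) ≤ Fintype.card V)
    (hG : ∀ v, (1 / 4 + ε) * Fintype.card V ≤ G.degree v)
    (hGc : ∀ v, (1 / 4 + ε) * Fintype.card V ≤ Gᶜ.degree v) :
    HasSeparatedCliques G t ∨ HasSeparatedCliques Gᶜ t := by
  by_contra! hcon
  set n := Fintype.card V
  obtain ⟨A, ρ, hρ, hA, hAc⟩ := exists_cliqueRich_and_cliqueRich_compl G hn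
  have hρn : 2 * T * (2 ^ T * ρ) ≤ t * n := by
    calc 2 * T * (2 ^ T * ρ) ≤ 2 ^ (2 * T) * (2 ^ T * ρ) := by
          gcongr; exact Nat.lt_two_pow_self.le
      _ = ρ * 2 ^ (3 * T) := by ring
      _ ≤ 1 * n := by rwa [one_mul]
      _ ≤ t * n := by gcongr; exact ht
  have hsparse {H : SimpleGraph V} [DecidableRel H.Adj] {B : Finset V}
      (hB : CliqueRich H T ρ B) (hH : ¬ HasSeparatedCliques H t) :
      T * #(Hᶜ.interedges B B) ≤ #B * (2 * t * n) := by
    refine (hB.mul_card_interedges_compl_self_le hH (ht.trans_le htT) htT).trans ?_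
    have : t * #B ≤ t * n := by gcongr; exact card_le_univ B
    gcongr
    linarith
  have hinnerA := hsparse hA hcon.1
  have hinnerAc : T * #(G.interedges Aᶜ Aᶜ) ≤ #Aᶜ * (2 * t * n) := by
    convert hsparse hAc hcon.2
    exact (compl_compl G).symm
  have hupper : (T : ℝ) * (#(Gᶜ.interedges A A) + #(G.interedges Aᶜ Aᶜ)) ≤ 2 * t * n ^ 2 := by
    have hcard : #A + #Aᶜ = n := card_add_card_compl A
    have := add_le_add hinnerA hinnerAc
    rw [← mul_add, ← add_mul, hcard] at this
    exact_mod_cast this.trans_eq (by ring)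
  have hlower := mul_sq_card_le_card_interedges_compl_add hG hGc A
  have hn_pos : 0 < n := (Nat.two_pow_pos _).trans_le hn
  have : 3 * t * (n : ℝ) ^ 2 ≤ 2 * t * (n : ℝ) ^ 2 :=
    calc 3 * t * (n : ℝ) ^ 2 ≤ ε * T * n ^ 2 := by gcongr
      _ = T * (ε * n ^ 2) := by ring
      _ ≤ _ := (mul_le_mul_of_nonneg_left hlower T.cast_nonneg).trans hupper
  have : 0 < t * (n : ℝ) ^ 2 := by positivity
  linarith

end Counting

@[simp]
theorem Colour.swap_swap (c : Colour) : c.swap.swap = c := by cases c <;> rfl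

theorem Colour.eq_swap_iff {c d : Colour} : c = d.swap ↔ c ≠ d := by
  cases c <;> cases d <;> simp [Colour.swap]

theorem labelGraph_swap (χ : Colouring V) (c : Colour) :
    χ.labelGraph c.swap = (χ.labelGraph c)ᶜ := by
  ext x y
  simp only [TopEdgeLabeling.labelGraph_adj, compl_adj, not_exists, Colour.eq_swap_iff]
  exact ⟨fun ⟨hne, hc⟩ => ⟨hne, fun _ => hc⟩, fun ⟨hne, hc⟩ => ⟨hne, hc hne⟩⟩

theorem LocallyBalanced.le_degree [Fintype V] {δ : ℝ} {χ : Colouring V}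
    (hχ : LocallyBalanced δ χ) (c : Colour) (v : V)
    [Fintype ((χ.labelGraph c).neighborSet v)] :
    δ * Fintype.card V ≤ (χ.labelGraph c).degree v := by
  rw [← card_neighborFinset_eq_degree, neighborFinset, ← Set.ncard_eq_toFinset_card']
  exact hχ v c

theorem LocallyBalanced.le_degree_compl [Fintype V] {δ : ℝ} {χ : Colouring V}
    (hχ : LocallyBalanced δ χ) (c : Colour) (v : V)
    [Fintype ((χ.labelGraph c)ᶜ.neighborSet v)] :
    δ * Fintype.card V ≤ (χ.labelGraph c)ᶜ.degree v := by
  rw [← card_neighborFinset_eq_degree, neighborFinset, ← Set.ncard_eq_toFinset_card',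
    ← labelGraph_swap]
  exact hχ v c.swap

theorem LocallyBalanced.lt_half [Fintype V] {δ : ℝ} {χ : Colouring V}
    (hχ : LocallyBalanced δ χ) (hV : 0 < (Fintype.card V : ℝ)) : δ < 1 / 2 := by
  classical
  obtain ⟨v⟩ := Fintype.card_pos_iff.1 (Nat.cast_pos.1 hV)
  have hred := hχ.le_degree .red v
  have hblue := hχ.le_degree_compl .red v
  have hsum : (χ.labelGraph .red).degree v + (χ.labelGraph .red)ᶜ.degree v < Fintype.card V := by
    have := (χ.labelGraph .red).degree_lt_card_verts v
    rw [degree_compl]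
    omega
  have : ((χ.labelGraph .red).degree v : ℝ) + (χ.labelGraph .red)ᶜ.degree v < Fintype.card V :=
    mod_cast hsum
  nlinarith

theorem containsBlowUp_const_iff {χ : Colouring V} {t : ℕ} {c : Colour}
    {H : TotallyColouredGraph (Fin 2)} (hgraph : H.graph = ⊤)
    (hvertex : ∀ i, H.vertexColour i = c) (hedge : ∀ i j h, H.edgeColour.get i j h = c.swap) :
    ContainsBlowUp χ t H ↔ HasSeparatedCliques (χ.labelGraph c) t := by
  simp only [ContainsBlowUp, HasSeparatedCliques, hvertex, hedge, hgraph, labelGraph_swap]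
  constructor
  · rintro ⟨S, hcard, -, hclique, hcross⟩
    have hnclique (i : Fin 2) : (χ.labelGraph c).IsNClique t (S i) :=
      ⟨fun x hx y hy hxy => hclique i x hx y hy hxy, hcard i⟩
    exact ⟨S 0, S 1, hnclique 0, hnclique 1, hcross 0 1 (by simp)⟩
  · rintro ⟨S, S', hS, hS', hcross⟩
    have hdisj : Disjoint S S' := disjoint_left.2 fun x hx hx' => (hcross x hx x hx').ne rfl
    refine ⟨![S, S'], ?_, ?_, ?_, ?_⟩ <;> simp only [Fin.forall_fin_two]
    · exact ⟨hS.card_eq, hS'.card_eq⟩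
    · simp [hdisj, hdisj.symm]
    · exact ⟨fun x hx y hy hxy => hS.isClique hx hy hxy,
        fun x hx y hy hxy => hS'.isClique hx hy hxy⟩
    · exact ⟨⟨fun h => absurd h (by simp), fun _ => hcross⟩,
        ⟨fun _ x hx y hy => (hcross y hy x hx).symm, fun h => absurd h (by simp)⟩⟩

theorem containsBlowUp_P₁_iff {χ : Colouring V} {t : ℕ} :
    ContainsBlowUp χ t P₁ ↔ HasSeparatedCliques (χ.labelGraph .red) t :=
  containsBlowUp_const_iff rfl (fun _ => rfl) (fun _ _ _ => rfl)

theorem containsBlowUp_P₁_bar_iff {χ : Colouring V} {t : ℕ} :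
    ContainsBlowUp χ t P₁.bar ↔ HasSeparatedCliques (χ.labelGraph .blue) t :=
  containsBlowUp_const_iff rfl (fun _ => rfl) (fun _ _ _ => rfl)

theorem HasSeparatedCliques.isIndContained {G : SimpleGraph V} {t : ℕ}
    (h : HasSeparatedCliques G t) : completeBipartiteGraph (Fin t) (Fin t) ⊴ Gᶜ := by
  obtain ⟨S, S', hS, hS', hcross⟩ := h
  let e := S.equivFinOfCardEq hS.card_eq
  let e' := S'.equivFinOfCardEq hS'.card_eq
  let f : Fin t ⊕ Fin t → V := Sum.elim (fun i => e.symm i) (fun i => e'.symm i)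
  have hf : f.Injective :=
    (Subtype.val_injective.comp e.symm.injective).sumElim
      (Subtype.val_injective.comp e'.symm.injective)
      fun i j => (hcross _ (e.symm i).2 _ (e'.symm j).2).ne
  refine ⟨⟨f, hf⟩, ?_⟩
  rintro (i | i) (j | j)
  · simpa [f] using fun hij => hS.isClique (e.symm i).2 (e.symm j).2 hij
  · simpa [f] using hcross _ (e.symm i).2 _ (e'.symm j).2
  · simpa [f] using (hcross _ (e.symm j).2 _ (e'.symm i).2).symm
  · simpa [f] using fun hij => hS'.isClique (e'.symm i).2 (e'.symm j).2 hij

theorem hasSeparatedCliques_of_isIndContained {G : SimpleGraph V} {t : ℕ}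
    (h : completeBipartiteGraph (Fin t) (Fin t) ⊴ Gᶜ) : HasSeparatedCliques G t := by
  obtain ⟨φ⟩ := h
  have hside (ι : Fin t ↪ Fin t ⊕ Fin t)
      (hι : ∀ i j, ¬ (completeBipartiteGraph (Fin t) (Fin t)).Adj (ι i) (ι j)) :
      G.IsNClique t (univ.map (ι.trans φ.toEmbedding)) := by
    refine ⟨?_, by simp⟩
    simp only [coe_map, coe_univ, Set.image_univ]
    rintro _ ⟨i, rfl⟩ _ ⟨j, rfl⟩ hij
    by_contra hadj
    exact hι i j (φ.map_adj_iff.1 ⟨hij, hadj⟩)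
  refine ⟨_, _, hside .inl (by simp), hside .inr (by simp), ?_⟩
  simp only [mem_map, mem_univ, true_and, forall_exists_index, forall_apply_eq_imp_iff]
  exact fun i j => φ.map_adj_iff.2 (by simp)

theorem hasInducedBipartite_iff_isIndContained {χ : Colouring V} {t : ℕ} :
    HasInducedBipartite χ t ↔
      ∃ c, completeBipartiteGraph (Fin t) (Fin t) ⊴ χ.labelGraph c := by
  refine exists_congr fun c => ⟨?_, fun h => ?_⟩
  · rintro ⟨S, -, ⟨φ⟩⟩
    exact ⟨(Embedding.induce _).comp φ.symm.toEmbedding⟩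
  · obtain ⟨s, ⟨φ⟩⟩ := isIndContained_iff_exists_iso_induce.1 h
    have hs : s.Finite := Finite.of_equiv _ φ.toEquiv
    lift s to Finset V using hs
    exact ⟨s, by simpa [two_mul] using (Fintype.card_congr φ.toEquiv).symm, ⟨φ.symm⟩⟩

theorem hasInducedBipartite_iff {χ : Colouring V} {t : ℕ} :
    HasInducedBipartite χ t ↔ ∃ c, HasSeparatedCliques (χ.labelGraph c) t := by
  rw [hasInducedBipartite_iff_isIndContained]
  constructor
  · rintro ⟨c, h⟩
    rw [← c.swap_swap, labelGraph_swap] at h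
    exact ⟨c.swap, hasSeparatedCliques_of_isIndContained h⟩
  · rintro ⟨c, h⟩
    exact ⟨c.swap, labelGraph_swap χ c ▸ h.isIndContained⟩

theorem LocallyBalanced.exists_hasSeparatedCliques [Fintype V] {ε : ℝ} (hε : 0 < ε) {t : ℕ}
    {χ : Colouring V} (hn : (2 : ℝ) ^ (32 * t / ε) ≤ Fintype.card V)
    (hχ : LocallyBalanced (1 / 4 + ε) χ) : ∃ c, HasSeparatedCliques (χ.labelGraph c) t := by
  classical
  obtain rfl | ht := Nat.eq_zero_or_pos t
  · exact ⟨.red, ∅, ∅, by simp⟩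
  have hV : 0 < (Fintype.card V : ℝ) := (Real.rpow_pos_of_pos two_pos _).trans_le hn
  have hε1 : ε < 1 := by linarith [hχ.lt_half hV]
  have ht_le : (t : ℝ) ≤ t / ε := le_div_self t.cast_nonneg hε hε1.le
  have ht1 : (1 : ℝ) ≤ t := mod_cast ht
  set T := ⌈3 * t / ε⌉₊
  have hT : 3 * t / ε ≤ T := Nat.le_ceil _
  have hT' : T < 3 * t / ε + 1 := Nat.ceil_lt_add_one (by positivity)
  rw [mul_div_assoc] at hT hT' hn
  have hcard : 2 ^ (8 * T) ≤ Fintype.card V := by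
    have : (2 : ℝ) ^ ((8 * T : ℕ) : ℝ) ≤ Fintype.card V :=
      (Real.rpow_le_rpow_of_exponent_le one_le_two (by push_cast; linarith)).trans hn
    exact_mod_cast this
  rcases hasSeparatedCliques_or_compl ht (T := T) (mod_cast (by linarith : (t : ℝ) ≤ T))
    (by rwa [← mul_div_assoc, div_le_iff₀' hε] at hT) hcard
    (fun v => hχ.le_degree .red v) (fun v => hχ.le_degree_compl .red v) with h | h
  · exact ⟨.red, h⟩
  · exact ⟨Colour.swap .red, labelGraph_swap χ .red ▸ h⟩

theorem fourPart_labelGraph_adj {k : ℕ} {c : Colour} {x y : Fin 4 × Fin k} :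
    ((fourPart k).labelGraph c).Adj x y ↔ x ≠ y ∧ partColour x.1 y.1 = c := by
  rw [TopEdgeLabeling.labelGraph_adj]
  exact ⟨fun ⟨hne, hc⟩ => ⟨hne, hc⟩, fun ⟨hne, hc⟩ => ⟨hne, hc⟩⟩

theorem partColour_cross_eq {c : Colour} : ∀ i i' j j' : Fin 4, partColour i i' = c →
    partColour j j' = c → partColour i j = c ∨ partColour i j' = c ∨
      partColour i' j = c ∨ partColour i' j' = c := by
  cases c <;> decide

theorem not_hasSeparatedCliques_fourPart {k t : ℕ} (ht : 2 ≤ t) (c : Colour) :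
    ¬ HasSeparatedCliques ((fourPart k).labelGraph c) t := by
  rintro ⟨S, S', hS, hS', hcross⟩
  have hcolour {a b} (ha : a ∈ S) (hb : b ∈ S') : partColour a.1 b.1 ≠ c := fun h =>
    (hcross a ha b hb).2 (fourPart_labelGraph_adj.2 ⟨(hcross a ha b hb).ne, h⟩)
  obtain ⟨x, hx, x', hx', hxx'⟩ := one_lt_card.1 (ht.trans_eq hS.card_eq.symm)
  obtain ⟨y, hy, y', hy', hyy'⟩ := one_lt_card.1 (ht.trans_eq hS'.card_eq.symm)
  have hS_colour := (fourPart_labelGraph_adj.1 (hS.isClique hx hx' hxx')).2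
  have hS'_colour := (fourPart_labelGraph_adj.1 (hS'.isClique hy hy' hyy')).2
  rcases partColour_cross_eq _ _ _ _ hS_colour hS'_colour with h | h | h | h
  exacts [hcolour hx hy h, hcolour hx hy' h, hcolour hx' hy h, hcolour hx' hy' h]

theorem exists_ne_partColour_eq (c : Colour) : ∀ i : Fin 4, ∃ j ≠ i, partColour i j = c := by
  cases c <;> decide

theorem locallyBalanced_fourPart (k : ℕ) : LocallyBalanced (1 / 4) (fourPart k) := by
  intro v c
  obtain ⟨j, hj, hc⟩ := exists_ne_partColour_eq c v.1
  have hsub : Set.range (fun a : Fin k => (j, a)) ⊆ ((fourPart k).labelGraph c).neighborSet v := by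
    rintro _ ⟨a, rfl⟩
    exact fourPart_labelGraph_adj.2 ⟨fun h => hj (by rw [h]), hc⟩
  have hk : k ≤ (((fourPart k).labelGraph c).neighborSet v).ncard := by
    simpa [← Set.image_univ, Set.ncard_image_of_injective _ (Prod.mk_right_injective j)] using
      Set.ncard_le_ncard hsub (Set.toFinite _)
  calc (1 / 4 : ℝ) * Fintype.card (Fin 4 × Fin k) = k := by simp
    _ ≤ _ := mod_cast hk

theorem div_le_two_rpow_log_pow {ε : ℝ} (hε : 0 < ε) (hε4 : ε < 1 / 4) :
    32 / ε ≤ 2 ^ (8 * Real.log (1 / ε) ^ 8) := by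
  have hinv : 4 < 1 / ε := by rw [lt_div_iff₀ hε]; linarith
  have hlog : 1 ≤ Real.log (1 / ε) := by
    rw [Real.le_log_iff_exp_le (by positivity)]
    linarith [Real.exp_one_lt_d9]
  have hpow : Real.log (1 / ε) ≤ Real.log (1 / ε) ^ 8 := le_self_pow₀ hlog (by norm_num)
  have hlog2 : 1 / 2 ≤ Real.log 2 := by linarith [Real.log_two_gt_d9]
  calc 32 / ε = 32 * (1 / ε) := by ring
    _ ≤ (1 / ε) ^ 3 * (1 / ε) := by
        gcongr
        calc (32 : ℝ) ≤ 4 ^ 3 := by norm_num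
          _ ≤ (1 / ε) ^ 3 := by gcongr
    _ = Real.exp (4 * Real.log (1 / ε)) := by
        rw [← pow_succ, ← Real.exp_log (by positivity : 0 < 1 / ε), ← Real.exp_nat_mul,
          Real.log_exp]
        norm_num
    _ ≤ Real.exp (Real.log 2 * (8 * Real.log (1 / ε) ^ 8)) := by
        apply Real.exp_le_exp.2
        nlinarith
    _ = _ := (Real.rpow_def_of_pos two_pos _).symm

theorem LocallyBalanced.two_rpow_le_card [Fintype V] {ε : ℝ} (hε : 0 < ε) {t : ℕ}
    {χ : Colouring V} (hχ : LocallyBalanced (1 / 4 + ε) χ)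
    (hn : (2 : ℝ) ^ (t * (2 : ℝ) ^ (8 * Real.log (1 / ε) ^ 8)) ≤ Fintype.card V) :
    (2 : ℝ) ^ (32 * t / ε) ≤ Fintype.card V := by
  have hV : 0 < (Fintype.card V : ℝ) := (Real.rpow_pos_of_pos two_pos _).trans_le hn
  refine (Real.rpow_le_rpow_of_exponent_le one_le_two ?_).trans hn
  calc 32 * t / ε = t * (32 / ε) := by ring
    _ ≤ _ := by
        gcongr
        exact div_le_two_rpow_log_pow hε (by linarith [hχ.lt_half hV])

end BalancedRamsey

open BalancedRamsey in
theorem mainTheorem2_general :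
    (∀ {V : Type*} [Fintype V] {ε : ℝ}, 0 < ε → ∀ {t : ℕ},
      (2 : ℝ) ^ (32 * t / ε) ≤ Fintype.card V →
      ∀ {χ : Colouring V}, LocallyBalanced (1 / 4 + ε) χ →
        (ContainsBlowUp χ t P₁ ∨ ContainsBlowUp χ t P₁.bar) ∧ HasInducedBipartite χ t) ∧
    ∀ k : ℕ, LocallyBalanced (1 / 4) (fourPart k) ∧
      ∀ t : ℕ, 2 ≤ t →
        ¬ ContainsBlowUp (fourPart k) t P₁ ∧
        ¬ ContainsBlowUp (fourPart k) t P₁.bar ∧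
        ¬ HasInducedBipartite (fourPart k) t := by
  simp only [containsBlowUp_P₁_iff, containsBlowUp_P₁_bar_iff, hasInducedBipartite_iff]
  refine ⟨fun hε t hn χ hχ => ?_, fun k => ⟨locallyBalanced_fourPart k, fun t ht => ?_⟩⟩
  · obtain ⟨c, hc⟩ := hχ.exists_hasSeparatedCliques hε hn
    exact ⟨by cases c <;> simp [hc], c, hc⟩
  · have hnone (c : Colour) := not_hasSeparatedCliques_fourPart (k := k) ht c
    exact ⟨hnone _, hnone _, fun ⟨c, hc⟩ => hnone c hc⟩

theorem mainTheorem2 :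
    (∃ C : ℝ, 0 < C ∧ ∀ ε : ℝ, 0 < ε → ∀ t n : ℕ,
      (2 : ℝ) ^ ((t : ℝ) * (2 : ℝ) ^ (C * (Real.log (1 / ε)) ^ 8)) ≤ (n : ℝ) →
      ∀ χ : BalancedRamsey.Colouring (Fin n),
        BalancedRamsey.LocallyBalanced (1 / 4 + ε) χ →
        (BalancedRamsey.ContainsBlowUp χ t BalancedRamsey.P₁ ∨
          BalancedRamsey.ContainsBlowUp χ t BalancedRamsey.P₁.bar) ∧
        BalancedRamsey.HasInducedBipartite χ t) ∧
    (∀ k : ℕ, 1 ≤ k →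
      BalancedRamsey.LocallyBalanced (1 / 4) (BalancedRamsey.fourPart k) ∧
      ∀ t : ℕ, 2 ≤ t →
        ¬ BalancedRamsey.ContainsBlowUp (BalancedRamsey.fourPart k) t BalancedRamsey.P₁ ∧
        ¬ BalancedRamsey.ContainsBlowUp (BalancedRamsey.fourPart k) t BalancedRamsey.P₁.bar ∧
        ¬ BalancedRamsey.HasInducedBipartite (BalancedRamsey.fourPart k) t) := by
  exact ⟨⟨8, by norm_num, fun ε hε t n hn χ hχ => mainTheorem2_general.1 hε
    (hχ.two_rpow_le_card hε (by simpa using hn)) hχ⟩, fun k _ => mainTheorem2_general.{0}.2 k⟩
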